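/- Fix integers $m\ge 0$ (number of letters) and $d\ge 0$. Let $\mathcal T$ be the set of non-planar rooted trees with edges decorated by letters of $\{1,\dots,m\}$. The tree product $\odot$ on $\mathcal T$ identifies the roots; its neutral element is the one-node tree, which is denoted by $\emptyset$ and identified with the empty forest. Let $T\subset\mathcal T$ be the set of planted trees (those whose root belongs to exactly one edge), so that $(\mathcal T,\odot)$ is the free commutative monoid on $T$. Let $C$ be the real vector space freely generated by $\mathcal T$, and let $(\hat C,\bullet)$ be the free commutative unital algebra generated by $\mathcal T\setminus\{\emptyset\}$. The monomials of $\hat C$ are the decorated forests, $\bullet$ is the disjoint union, the unit is the empty forest $\emptyset$, and $C\subset\hat C$. The extraction–contraction coproduct of $\hat C$ is $$\hat\Delta\tau=\sum_{\sigma\subseteq\tau}\sigma\otimes\tau/\sigma ,$$ where $\sigma$ runs over all subsets of the set of edges of the forest $\tau$, identified with the corresponding subforest (components without edges being dropped), and $\tau/\sigma$ is obtained by contracting each connected component of $\sigma$ to a node. It restricts to a coaction $\delta:C\to\hat C\otimes C$. Let $\hat\varepsilon(\sigma)=\mathbf 1_{(\sigma=\emptyset)}$ for forests $\sigma$. For linear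 functionals $\alpha,\beta:\hat C\to\mathbb R$ put $\alpha\mathbin{\hat\star}\beta=(\alpha\otimes\beta)\hat\Delta$ and $\psi_\alpha=(\alpha\otimes\mathrm{id})\delta:C\to C$. A character is a unital algebra morphism $\hat C\to\mathbb R$. For a family $\Pi=(\langle\Pi,\tau\rangle)_{\tau\in T}$ in the space $\mathcal C(\mathbb R^d)$ of continuous functions $\mathbb R^d\to\mathbb R$, let $R\Pi$ be the unique family $(\langle R\Pi,\tau\rangle)_{\tau\in\mathcal T}$ that is multiplicative from $(\mathcal T,\odot)$ to $\mathcal C(\mathbb R^d)$ with the pointwise product, satisfies $\langle R\Pi,\emptyset\rangle=1$, and agrees with $\Pi$ on $T$; extend it linearly to $C$. **Theorem 9.1.** Let $X$ be a $\mathcal C(\mathbb R^d)^T$-valued random variable, extended by the convention $\langle X,\emptyset\rangle=1$, such that for all $\tau\in T$ and $x\in\mathbb R^d$ the function $\langle X,\tau\rangle(\cdot+x)$ has the same law as $\langle X,\tau\rangle$, and such that $\langle X,\tau\rangle(0)$ has finite moments of all orders for all $\tau\in T$. Then: 1. $\langle RX,c\rangle(0)$ is integrable for every $c\in C$, and there is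 a unique character $\hat\mu$ on $(\hat C,\bullet)$ with $\hat\mu(\tau)=\mathbb E(\langle RX,\tau\rangle(0))$ for all $\tau\in\mathcal T$. 2. There is a unique linear functional $\hat\mu^{-1}:\hat C\to\mathbb R$ with $\hat\mu^{-1}\mathbin{\hat\star}\hat\mu=\hat\mu\mathbin{\hat\star}\hat\mu^{-1}=\hat\varepsilon$, and it is a character. 3. $\lambda=\hat\mu^{-1}$ is the unique character on $(\hat C,\bullet)$ such that $$\mathbb E\big(\langle RX,\psi_\lambda\tau\rangle(0)\big)=0\qquad\text{for all }\tau\in\mathcal T\setminus\{\emptyset\}.$$ -/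

import Mathlib

open scoped TensorProduct

namespace WickTrees

universe u

/-- Planar rooted trees with edges decorated by letters of `A`. `nil` is the tree with a single node
(its root) and no edge; `graft a t s` is obtained from `s` by attaching to the root of `s` a new first
edge, decorated by `a`, whose upper end is the root of `t`. -/
inductive PTree (A : Type u) : Type u
  | nil : PTree A
  | graft (a : A) (t s : PTree A) : PTree A

namespace PTree

variable {A : Type u}

/-- The type of edges of a planar tree. In `graft a t s`, the edge `none` is the new edge
decorated by `a`, the edges `some (Sum.inl e)` are those of `t`, and `some (Sum.inr e)` those of `s`. -/
def Edge : PTree A → Type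
  | nil => Empty
  | graft _ t s => Option (Edge t ⊕ Edge s)

instance Edge.instFintype : (t : PTree A) → Fintype (Edge t)
  | nil => inferInstanceAs (Fintype Empty)
  | graft _ t s =>
    letI := Edge.instFintype t
    letI := Edge.instFintype s
    inferInstanceAs (Fintype (Option (Edge t ⊕ Edge s)))

instance Edge.instDecidableEq : (t : PTree A) → DecidableEq (Edge t)
  | nil => inferInstanceAs (DecidableEq Empty)
  | graft _ t s =>
    letI := Edge.instDecidableEq t
    letI := Edge.instDecidableEq s
    inferInstanceAs (DecidableEq (Option (Edge t ⊕ Edge s)))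

/-- A subset of the set of edges of `t`, given by its indicator function. -/
abbrev EdgeSet (t : PTree A) : Type := Edge t → Bool

/-- Whether the new edge of `graft a t s` belongs to the subset. -/
def EdgeSet.new {a : A} {t s : PTree A} (σ : EdgeSet (graft a t s)) : Bool := σ none

/-- The part of a subset of edges of `graft a t s` that lies in `t`. -/
def EdgeSet.fst {a : A} {t s : PTree A} (σ : EdgeSet (graft a t s)) : EdgeSet t :=
  fun e => σ (some (Sum.inl e))

/-- The part of a subset of edges of `graft a t s` that lies in `s`. -/
def EdgeSet.snd {a : A} {t s : PTree A} (σ : EdgeSet (graft a t s)) : EdgeSet s :=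
  fun e => σ (some (Sum.inr e))

/-- Identification of the roots of two planar trees. -/
def join : PTree A → PTree A → PTree A
  | nil, r => r
  | graft a t s, r => graft a t (join s r)

/-- The connected component of the root in the subgraph of `t` (on all nodes of `t`) whose edges are
those of `σ`. -/
def rootComponent : (t : PTree A) → EdgeSet t → PTree A
  | nil, _ => nil
  | graft a t s, σ =>
    if σ.new then graft a (rootComponent t σ.fst) (rootComponent s σ.snd)
    else rootComponent s σ.snd

/-- The tree obtained from `t` by contracting every edge of `σ`, that is, by contracting every
connected component of `σ` to a single node. -/
def contract : (t : PTree A) → EdgeSet t → PTree A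
  | nil, _ => nil
  | graft a t s, σ =>
    if σ.new then join (contract t σ.fst) (contract s σ.snd)
    else graft a (contract t σ.fst) (contract s σ.snd)

/-- Two planar trees represent the same non-planar tree: the congruence generated by exchanging
two consecutive branches at a node. -/
inductive Iso : PTree A → PTree A → Prop
  | refl (t : PTree A) : Iso t t
  | symm {t s : PTree A} : Iso t s → Iso s t
  | trans {t s r : PTree A} : Iso t s → Iso s r → Iso t r
  | congr (a : A) {t t' s s' : PTree A} : Iso t t' → Iso s s' → Iso (graft a t s) (graft a t' s')
  | swap (a b : A) (t u s : PTree A) : Iso (graft a t (graft b u s)) (graft b u (graft a t s))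

instance setoid (A : Type u) : Setoid (PTree A) where
  r := Iso
  iseqv := ⟨Iso.refl, Iso.symm, Iso.trans⟩

theorem Iso.join_right {r r' : PTree A} (h : Iso r r') :
    ∀ t : PTree A, Iso (join t r) (join t r')
  | nil => h
  | graft a t s => Iso.congr a (Iso.refl t) (Iso.join_right h s)

theorem Iso.join_left {t t' : PTree A} (h : Iso t t') (r : PTree A) :
    Iso (join t r) (join t' r) := by
  induction h with
  | refl t => exact Iso.refl _
  | symm _ ih => exact ih.symm
  | trans _ _ ih₁ ih₂ => exact ih₁.trans ih₂
  | congr a h₁ _ _ ih₂ => exact Iso.congr a h₁ ih₂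
  | swap a b t u s => exact Iso.swap a b t u _

theorem join_nil : ∀ t : PTree A, join t nil = t
  | nil => rfl
  | graft a t s => congrArg (graft a t) (join_nil s)

theorem join_assoc (s r : PTree A) :
    ∀ t : PTree A, join (join t s) r = join t (join s r)
  | nil => rfl
  | graft a t t' => congrArg (graft a t) (join_assoc s r t')

theorem join_graft_iso (a : A) (u s : PTree A) :
    ∀ t : PTree A, Iso (join t (graft a u s)) (graft a u (join t s))
  | nil => Iso.refl _
  | graft b t t' => (Iso.congr b (Iso.refl t) (join_graft_iso a u s t')).trans (Iso.swap b a t u _)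

theorem join_comm_iso (s : PTree A) : ∀ t : PTree A, Iso (join t s) (join s t)
  | nil => by rw [join_nil]; exact Iso.refl _
  | graft a t t' =>
    (Iso.congr a (Iso.refl t) (join_comm_iso s t')).trans (join_graft_iso a t t' s).symm

end PTree

/-- Non-planar rooted trees with edges decorated by letters of `A`. -/
def RTree (A : Type u) : Type u := Quotient (PTree.setoid A)

namespace RTree

variable {A : Type u}

/-- The non-planar tree represented by a planar tree. -/
def mk (t : PTree A) : RTree A := Quotient.mk (PTree.setoid A) t

theorem mk_eq_mk {t s : PTree A} : mk t = mk s ↔ PTree.Iso t s :=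
  ⟨fun h => Quotient.exact h, fun h => Quotient.sound h⟩

/-- The tree product (identification of the roots); its neutral element is the tree with a single
node, which is identified with the empty forest. -/
instance instCommMonoid : CommMonoid (RTree A) where
  mul := Quotient.map₂ PTree.join fun _ t' h _ _ h' => (h.join_left _).trans (h'.join_right t')
  one := mk PTree.nil
  mul_assoc := by
    rintro ⟨t⟩ ⟨s⟩ ⟨r⟩
    exact congrArg mk (PTree.join_assoc s r t)
  one_mul := by
    rintro ⟨t⟩
    rfl
  mul_one := by
    rintro ⟨t⟩
    exact congrArg mk (PTree.join_nil t)
  mul_comm := by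
    rintro ⟨t⟩ ⟨s⟩
    exact mk_eq_mk.2 (PTree.join_comm_iso s t)

theorem mk_nil : mk (PTree.nil : PTree A) = 1 := rfl

theorem mk_join (t s : PTree A) : mk (PTree.join t s) = mk t * mk s := rfl

/-- The planted tree with trunk decorated by `a`, above which sits the tree `τ`. -/
def plant (a : A) : RTree A → RTree A :=
  Quotient.map (fun t => PTree.graft a t PTree.nil) fun _ _ h => PTree.Iso.congr a h (PTree.Iso.refl _)

theorem mk_graft (a : A) (t s : PTree A) : mk (PTree.graft a t s) = plant a (mk t) * mk s := rfl

/-- A tree is planted if its root belongs to a single edge, the trunk. -/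
def IsPlanted (τ : RTree A) : Prop := ∃ (a : A) (ρ : RTree A), τ = plant a ρ

end RTree

/-- The set of planted trees. -/
abbrev PlantedTree (A : Type u) : Type u := {τ : RTree A // τ.IsPlanted}

/-- The set of trees with at least one edge. -/
abbrev NonemptyTree (A : Type u) : Type u := {τ : RTree A // τ ≠ 1}

/-- The vector space freely generated by the trees. -/
abbrev TreeSpace (A : Type u) : Type u := RTree A →₀ ℝ

/-- The free commutative unital algebra generated by the nonempty trees. Its monomials are the
forests, its product is the disjoint union, and its unit is the empty forest. -/
abbrev ForestAlgebra (A : Type u) : Type u := MvPolynomial (NonemptyTree A) ℝ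

section Coproduct

variable {A : Type u}

open Classical in
/-- A tree as a forest; the tree with a single node is identified with the empty forest. -/
noncomputable def treeForest (τ : RTree A) : ForestAlgebra A :=
  if h : τ = 1 then 1 else MvPolynomial.X ⟨τ, h⟩

/-- The canonical embedding of the tree space in the forest algebra. -/
noncomputable def embed : TreeSpace A →ₗ[ℝ] ForestAlgebra A :=
  Finsupp.linearCombination ℝ treeForest

theorem treeForest_one : treeForest (1 : RTree A) = 1 := by simp [treeForest]

theorem embed_single (τ : RTree A) : embed (Finsupp.single τ 1) = treeForest τ := by
  simp [embed]

namespace PTree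

/-- The connected components that do not contain the root, in the subgraph of `t` (on all nodes
of `t`) whose edges are those of `σ`. Each one is rooted at its node closest to the root of `t`. -/
def otherComponents : (t : PTree A) → EdgeSet t → Multiset (RTree A)
  | nil, _ => 0
  | graft _ t s, σ =>
    (if σ.new then 0 else {RTree.mk (rootComponent t σ.fst)}) +
      (otherComponents t σ.fst + otherComponents s σ.snd)

/-- All connected components of the subgraph of `t` whose edges are those of `σ`, including those
which are reduced to a node. -/
def components (t : PTree A) (σ : EdgeSet t) : Multiset (RTree A) :=
  RTree.mk (rootComponent t σ) ::ₘ otherComponents t σ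

/-- The subforest of `t` determined by the subset `σ` of edges: the disjoint union of the
connected components, those without edges being dropped. -/
noncomputable def subforest (t : PTree A) (σ : EdgeSet t) : ForestAlgebra A :=
  ((components t σ).map treeForest).prod

/-- The sum over all subsets `σ` of edges of the tensor products `σ ⊗ t / σ`. -/
noncomputable def extract (t : PTree A) : ForestAlgebra A ⊗[ℝ] TreeSpace A :=
  ∑ σ : EdgeSet t, subforest t σ ⊗ₜ[ℝ] Finsupp.single (RTree.mk (contract t σ)) (1 : ℝ)

/-- Exchange of branches induces a bijection of edges compatible with extraction and contraction. -/
theorem Iso.exists_edge_equiv {t t' : PTree A} (h : Iso t t') :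
    ∃ f : Edge t ≃ Edge t', ∀ σ : EdgeSet t',
      Iso (rootComponent t fun e => σ (f e)) (rootComponent t' σ) ∧
      otherComponents t (fun e => σ (f e)) = otherComponents t' σ ∧
      Iso (contract t fun e => σ (f e)) (contract t' σ) := by
  induction h with
  | refl t => exact ⟨Equiv.refl _, fun σ => ⟨Iso.refl _, rfl, Iso.refl _⟩⟩
  | symm _ ih =>
    obtain ⟨f, hf⟩ := ih
    refine ⟨f.symm, fun σ => ?_⟩
    have := hf fun e => σ (f.symm e)
    simp only [Equiv.symm_apply_apply] at this
    exact ⟨this.1.symm, this.2.1.symm, this.2.2.symm⟩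
  | trans _ _ ih₁ ih₂ =>
    obtain ⟨f, hf⟩ := ih₁
    obtain ⟨g, hg⟩ := ih₂
    refine ⟨f.trans g, fun σ => ?_⟩
    have h₁ := hf fun e => σ (g e)
    have h₂ := hg σ
    exact ⟨h₁.1.trans h₂.1, h₁.2.1.trans h₂.2.1, h₁.2.2.trans h₂.2.2⟩
  | @congr a t t' s s' _ _ ih₁ ih₂ =>
    obtain ⟨f, hf⟩ := ih₁
    obtain ⟨g, hg⟩ := ih₂
    refine ⟨Equiv.optionCongr (Equiv.sumCongr f g), fun σ => ?_⟩
    have h₁ := hf (EdgeSet.fst σ)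
    have h₂ := hg (EdgeSet.snd σ)
    suffices key : ∀ τ : EdgeSet (graft a t s), τ.new = EdgeSet.new σ →
        τ.fst = (fun e => EdgeSet.fst σ (f e)) → τ.snd = (fun e => EdgeSet.snd σ (g e)) →
        Iso (rootComponent _ τ) (rootComponent _ σ) ∧ otherComponents _ τ = otherComponents _ σ ∧
          Iso (contract _ τ) (contract _ σ) from key _ rfl rfl rfl
    intro τ e₁ e₂ e₃
    simp only [rootComponent, otherComponents, contract, e₁, e₂, e₃]
    cases EdgeSet.new σ
    · simp only [Bool.false_eq_true, if_false]
      refine ⟨h₂.1, ?_, Iso.congr a h₁.2.2 h₂.2.2⟩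
      rw [h₁.2.1, h₂.2.1, RTree.mk_eq_mk.2 h₁.1]
    · simp only [if_true]
      refine ⟨Iso.congr a h₁.1 h₂.1, ?_, (h₁.2.2.join_left _).trans (h₂.2.2.join_right _)⟩
      rw [h₁.2.1, h₂.2.1]
  | swap a b t u s =>
    let F : Option (Edge t ⊕ Option (Edge u ⊕ Edge s)) → Option (Edge u ⊕ Option (Edge t ⊕ Edge s))
      | none => some (Sum.inr none)
      | some (Sum.inl e) => some (Sum.inr (some (Sum.inl e)))
      | some (Sum.inr none) => none
      | some (Sum.inr (some (Sum.inl e))) => some (Sum.inl e)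
      | some (Sum.inr (some (Sum.inr e))) => some (Sum.inr (some (Sum.inr e)))
    let G : Option (Edge u ⊕ Option (Edge t ⊕ Edge s)) → Option (Edge t ⊕ Option (Edge u ⊕ Edge s))
      | none => some (Sum.inr none)
      | some (Sum.inl e) => some (Sum.inr (some (Sum.inl e)))
      | some (Sum.inr none) => none
      | some (Sum.inr (some (Sum.inl e))) => some (Sum.inl e)
      | some (Sum.inr (some (Sum.inr e))) => some (Sum.inr (some (Sum.inr e)))
    have hGF : Function.LeftInverse G F := by rintro (_ | _ | _ | _ | _) <;> rfl
    have hFG : Function.RightInverse G F := by rintro (_ | _ | _ | _ | _) <;> rfl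
    refine ⟨⟨F, G, hGF, hFG⟩, fun σ => ?_⟩
    suffices key : ∀ τ : EdgeSet (graft a t (graft b u s)), τ.new = (EdgeSet.snd σ).new →
        τ.fst = (EdgeSet.snd σ).fst → τ.snd.new = EdgeSet.new σ → τ.snd.fst = EdgeSet.fst σ →
        τ.snd.snd = (EdgeSet.snd σ).snd →
        Iso (rootComponent _ τ) (rootComponent _ σ) ∧ otherComponents _ τ = otherComponents _ σ ∧
          Iso (contract _ τ) (contract _ σ) from key _ rfl rfl rfl rfl rfl
    intro τ e₁ e₂ e₃ e₄ e₅
    simp only [rootComponent, otherComponents, contract, e₁, e₂, e₃, e₄, e₅]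
    refine ⟨?_, by ac_rfl, ?_⟩
    · cases EdgeSet.new σ <;> cases (EdgeSet.snd σ).new <;>
        first | exact Iso.refl _ | exact Iso.swap a b _ _ _
    · cases EdgeSet.new σ <;> cases (EdgeSet.snd σ).new <;>
        simp only [Bool.false_eq_true, if_false, if_true]
      · exact Iso.swap a b _ _ _
      · exact join_graft_iso _ _ _ _
      · exact (join_graft_iso _ _ _ _).symm
      · rw [← join_assoc, ← join_assoc]
        exact (join_comm_iso _ _).join_left _

theorem extract_eq_of_iso {t t' : PTree A} (h : Iso t t') : extract t = extract t' := by
  obtain ⟨f, hf⟩ := h.exists_edge_equiv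
  refine (Fintype.sum_equiv (f.symm.arrowCongr (Equiv.refl Bool)) _ _ fun σ => ?_).symm
  obtain ⟨h₁, h₂, h₃⟩ := hf σ
  change _ = subforest t (fun e => σ (f e)) ⊗ₜ[ℝ]
    Finsupp.single (RTree.mk (contract t fun e => σ (f e))) (1 : ℝ)
  simp only [subforest, components]
  rw [RTree.mk_eq_mk.2 h₁, h₂, RTree.mk_eq_mk.2 h₃]

end PTree

/-- The extraction-contraction of a non-planar tree. -/
noncomputable def RTree.extract : RTree A → ForestAlgebra A ⊗[ℝ] TreeSpace A :=
  Quotient.lift PTree.extract fun _ _ h => PTree.extract_eq_of_iso h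

/-- The coaction of the forest algebra on the tree space. -/
noncomputable def coaction : TreeSpace A →ₗ[ℝ] ForestAlgebra A ⊗[ℝ] TreeSpace A :=
  Finsupp.linearCombination ℝ RTree.extract

/-- The extraction-contraction coproduct on the forest algebra. On a tree it is the sum over all
subforests `σ` of `σ ⊗ τ / σ`; on a disjoint union of trees, whose subsets of edges are the disjoint
unions of subsets of edges of the components, it is the product. -/
noncomputable def coproduct : ForestAlgebra A →ₐ[ℝ] ForestAlgebra A ⊗[ℝ] ForestAlgebra A :=
  MvPolynomial.aeval fun τ : NonemptyTree A => (embed.lTensor (ForestAlgebra A)) τ.1.extract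

theorem coproduct_treeForest (t : PTree A) :
    coproduct (treeForest (RTree.mk t)) =
      ∑ σ : t.EdgeSet, t.subforest σ ⊗ₜ[ℝ] treeForest (RTree.mk (t.contract σ)) := by
  have key : ∀ s : PTree A, (embed.lTensor (ForestAlgebra A)) (RTree.mk s).extract =
      ∑ σ : s.EdgeSet, s.subforest σ ⊗ₜ[ℝ] treeForest (RTree.mk (s.contract σ)) := by
    intro s
    change (embed.lTensor (ForestAlgebra A)) s.extract = _
    simp [PTree.extract, embed_single]
  by_cases h : RTree.mk t = 1
  · have h' : (RTree.mk t).extract = (RTree.mk (PTree.nil : PTree A)).extract := by rw [h]; rfl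
    rw [← key, h', key, h, treeForest_one, map_one]
    change _ = ∑ σ : Empty → Bool, _
    rw [Fintype.sum_unique]
    simp [PTree.subforest, PTree.components, PTree.rootComponent, PTree.otherComponents,
      PTree.contract, RTree.mk_nil, treeForest_one, Algebra.TensorProduct.one_def]
  · rw [← key, treeForest, dif_neg h, coproduct, MvPolynomial.aeval_X]

/-- On a forest, the coproduct is the sum over all subsets of edges of the forest. -/
theorem coproduct_forest {n : ℕ} (t : Fin n → PTree A) :
    coproduct (∏ i, treeForest (RTree.mk (t i))) =
      ∑ σ : (i : Fin n) → (t i).EdgeSet,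
        (∏ i, (t i).subforest (σ i)) ⊗ₜ[ℝ] ∏ i, treeForest (RTree.mk ((t i).contract (σ i))) := by
  have tmul_prod : ∀ (s : Finset (Fin n)) (f g : Fin n → ForestAlgebra A),
      ∏ i ∈ s, (f i ⊗ₜ[ℝ] g i) = (∏ i ∈ s, f i) ⊗ₜ[ℝ] ∏ i ∈ s, g i := by
    intro s f g
    induction s using Finset.cons_induction with
    | empty => rfl
    | cons i s hi ih => simp only [Finset.prod_cons, ih, Algebra.TensorProduct.tmul_mul_tmul]
  rw [map_prod]
  simp only [coproduct_treeForest, Finset.prod_univ_sum, tmul_prod, Fintype.piFinset_univ]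

/-- The counit, equal to `1` on the empty forest and to `0` on all other forests. -/
noncomputable def counit : ForestAlgebra A →ₐ[ℝ] ℝ := MvPolynomial.aeval fun _ => 0

/-- The convolution product of linear functionals on the forest algebra. -/
noncomputable def conv (α β : ForestAlgebra A →ₗ[ℝ] ℝ) : ForestAlgebra A →ₗ[ℝ] ℝ :=
  LinearMap.mul' ℝ ℝ ∘ₗ TensorProduct.map α β ∘ₗ coproduct.toLinearMap

/-- `α` and `β` are inverse to each other for the convolution product. -/
def IsConvInverse (α β : ForestAlgebra A →ₗ[ℝ] ℝ) : Prop :=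
  conv α β = counit.toLinearMap ∧ conv β α = counit.toLinearMap

/-- The operator `(α ⊗ id) δ` on the tree space, where `δ` is the coaction. -/
noncomputable def psi (α : ForestAlgebra A →ₗ[ℝ] ℝ) : TreeSpace A →ₗ[ℝ] TreeSpace A :=
  (TensorProduct.lid ℝ (TreeSpace A)).toLinearMap ∘ₗ α.rTensor (TreeSpace A) ∘ₗ coaction

end Coproduct

section Lift

variable {A : Type u}

/-- `ℝ ^ d`. -/
abbrev Space (d : ℕ) : Type := EuclideanSpace ℝ (Fin d)

/-- The Borel σ-algebra of the topology of locally uniform convergence. -/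
instance instMeasurableSpaceC (d : ℕ) : MeasurableSpace C(Space d, ℝ) := borel _

instance instBorelSpaceC (d : ℕ) : BorelSpace C(Space d, ℝ) := ⟨rfl⟩

/-- The shifted function `f (· + x)`. -/
def shift {d : ℕ} (x : Space d) (f : C(Space d, ℝ)) : C(Space d, ℝ) :=
  f.comp ⟨fun y => y + x, by fun_prop⟩

/-- The product of `Φ` over the planted trees which make up a planar tree. -/
def PTree.lift {d : ℕ} (Φ : PlantedTree A → C(Space d, ℝ)) : PTree A → C(Space d, ℝ)
  | PTree.nil => 1
  | PTree.graft a t s => Φ ⟨RTree.plant a (RTree.mk t), a, RTree.mk t, rfl⟩ * PTree.lift Φ s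

theorem PTree.lift_eq_of_iso {d : ℕ} (Φ : PlantedTree A → C(Space d, ℝ)) {t t' : PTree A}
    (h : PTree.Iso t t') : PTree.lift Φ t = PTree.lift Φ t' := by
  induction h with
  | refl t => rfl
  | symm _ ih => exact ih.symm
  | trans _ _ ih₁ ih₂ => exact ih₁.trans ih₂
  | congr a h₁ _ _ ih₂ => simp only [PTree.lift, ih₂, RTree.mk_eq_mk.2 h₁]
  | swap a b t u s => exact mul_left_comm _ _ _

theorem PTree.lift_join {d : ℕ} (Φ : PlantedTree A → C(Space d, ℝ)) (s : PTree A) :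
    ∀ t : PTree A, PTree.lift Φ (PTree.join t s) = PTree.lift Φ t * PTree.lift Φ s
  | PTree.nil => (one_mul _).symm
  | PTree.graft a t t' => by
    simp only [PTree.lift, PTree.join, PTree.lift_join Φ s t', mul_assoc]

/-- The canonical lift of a family of functions indexed by planted trees: the character on
trees, for the tree product and the pointwise product, which extends it. -/
def canonicalLift {d : ℕ} (Φ : PlantedTree A → C(Space d, ℝ)) : RTree A →* C(Space d, ℝ) where
  toFun := Quotient.lift (PTree.lift Φ) fun _ _ h => PTree.lift_eq_of_iso Φ h
  map_one' := rfl
  map_mul' := by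
    rintro ⟨t⟩ ⟨s⟩
    exact PTree.lift_join Φ s t

theorem canonicalLift_planted {d : ℕ} (Φ : PlantedTree A → C(Space d, ℝ)) (τ : PlantedTree A) :
    canonicalLift Φ τ.1 = Φ τ := by
  obtain ⟨_, a, ⟨t⟩, rfl⟩ := τ
  exact mul_one _

/-- The canonical lift is the only character which extends the given family. -/
theorem canonicalLift_unique {d : ℕ} (Φ : PlantedTree A → C(Space d, ℝ))
    (Γ : RTree A →* C(Space d, ℝ)) (h : ∀ τ : PlantedTree A, Γ τ.1 = Φ τ) :
    Γ = canonicalLift Φ := by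
  have key : ∀ t : PTree A, Γ (RTree.mk t) = canonicalLift Φ (RTree.mk t) := by
    intro t
    induction t with
    | nil => rw [RTree.mk_nil, map_one, map_one]
    | graft a t s _ ih =>
      rw [RTree.mk_graft, map_mul, map_mul, ih]
      congr 1
      exact (h ⟨_, a, RTree.mk t, rfl⟩).trans (canonicalLift_planted Φ ⟨_, a, RTree.mk t, rfl⟩).symm
  ext1 τ
  obtain ⟨t⟩ := τ
  exact key t

/-- The linear extension of the canonical lift to the tree space. -/
noncomputable def liftC {d : ℕ} (Φ : PlantedTree A → C(Space d, ℝ)) :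
    TreeSpace A →ₗ[ℝ] C(Space d, ℝ) :=
  Finsupp.linearCombination ℝ (canonicalLift Φ)

end Lift

section Probability

open MeasureTheory

variable {A : Type u} {d : ℕ} {Ω : Type*} [MeasurableSpace Ω]

/-- Every function `X τ (· + x)` has the same law as `X τ`. -/
def IsStationaryFamily (X : Ω → PlantedTree A → C(Space d, ℝ)) (P : Measure Ω) : Prop :=
  ∀ (x : Space d) (τ : PlantedTree A),
    ProbabilityTheory.IdentDistrib (fun ω => shift x (X ω τ)) (fun ω => X ω τ) P P

/-- Every random variable `X τ 0` has finite moments of all orders. -/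
def HasFiniteMoments (X : Ω → PlantedTree A → C(Space d, ℝ)) (P : Measure Ω) : Prop :=
  ∀ (τ : PlantedTree A) (p : ℕ), Integrable (fun ω => |X ω τ 0| ^ p) P

/-- The linear functional on the tree space which maps a tree `τ` to the expectation of the
canonical lift of `X` on `τ` at `0`. -/
noncomputable def mean (X : Ω → PlantedTree A → C(Space d, ℝ)) (P : Measure Ω) :
    TreeSpace A →ₗ[ℝ] ℝ :=
  Finsupp.linearCombination ℝ fun τ => ∫ ω, canonicalLift (X ω) τ 0 ∂P

/-- The character on the forest algebra with the values of `mean X P` on nonempty trees. -/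
noncomputable def meanChar (X : Ω → PlantedTree A → C(Space d, ℝ)) (P : Measure Ω) :
    ForestAlgebra A →ₐ[ℝ] ℝ :=
  MvPolynomial.aeval fun τ : NonemptyTree A => mean X P (Finsupp.single τ.1 1)

end Probability

end WickTrees

open MeasureTheory WickTrees

/-! The expectation of `⟨RX, ψ_ℓ τ⟩(0)` equals `(ℓ ⋆ μ)(τ)`, where `μ` is the character of means:
both are the sum over edge subsets `σ` of `ℓ(σ) μ(τ/σ)` (`convAlgHom_eq_apply_psi`). Since `ℓ ⋆ μ`
is a character, centring on all nonempty trees says exactly that `ℓ ⋆ μ` is the counit. Everything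
thus reduces to inverting `μ` for convolution.

Characters form a monoid: associativity is coassociativity of extraction-contraction, proved by
recursion on planar trees (`edgeSum_edgeSum`). Contracting a nonempty subset lowers the number of
edges, so `ψ_α` is the identity plus a locally nilpotent operator. A Neumann series then yields a
functional on trees, extended multiplicatively to a right inverse of `α`
(`exists_convAlgHom_eq_counit`). As every character has a right inverse, these are two-sided.
Uniqueness among all linear functionals follows because `α ↦ α ⋆ β` is precomposition with an
invertible operator (`eq_of_conv_eq_counit`). Integrability is Hölder's inequality. -/

namespace WickTrees

universe u v

/-! ### Recursive sums over edge subsets, and coassociativity. -/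

namespace PTree

variable {A : Type u} {B : Type v}

/-- The number of edges. -/
def size : PTree A → ℕ
  | nil => 0
  | graft _ t s => size t + size s + 1

theorem size_join (s : PTree A) : ∀ t : PTree A, size (join t s) = size t + size s
  | nil => (Nat.zero_add _).symm
  | graft a t t' => by simp only [join, size, size_join s t']; omega

theorem join_eq_nil {t s : PTree A} (h : join t s = nil) : t = nil ∧ s = nil := by
  cases t with
  | nil => exact ⟨rfl, h⟩
  | graft a t t' => cases h

/-- Subsets of edges of `graft a t s`, decomposed along the new edge, `t` and `s`. -/
def edgeSetGraft (a : A) (t s : PTree A) :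
    EdgeSet (graft a t s) ≃ Bool × EdgeSet t × EdgeSet s where
  toFun σ := (σ.new, σ.fst, σ.snd)
  invFun p := fun e => match e with
    | none => p.1
    | some (Sum.inl e) => p.2.1 e
    | some (Sum.inr e) => p.2.2 e
  left_inv σ := by funext e; rcases e with _ | e | e <;> rfl
  right_inv _ := rfl

section Semiring

variable [CommSemiring B]

/-- The sum of `f r c` over all subsets of edges of `t`, where `r` is the component of the root and
`c` the contracted tree, each term weighted by the product of `w` over the other components. -/
def edgeSum (w : RTree A → B) : PTree A → (PTree A → PTree A → B) → B
  | nil, f => f nil nil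
  | graft a t s, f => edgeSum w t fun r c => edgeSum w s fun r' c' =>
      f (graft a r r') (join c c') + w (RTree.mk r) * f r' (graft a c c')

/-- A subset of edges either contains the trunk of the first branch or not, which gives the two
terms of the recursion. The recursive form spares iterated sums from indexing by edges of a
component or of a contracted tree, types that depend on the first subset. -/
theorem edgeSum_eq_sum (w : RTree A → B) (t : PTree A) (f : PTree A → PTree A → B) :
    edgeSum w t f = ∑ σ : EdgeSet t,
      ((otherComponents t σ).map w).prod * f (rootComponent t σ) (contract t σ) := by
  induction t generalizing f with
  | nil =>
    change _ = ∑ σ : Empty → Bool, _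
    rw [Fintype.sum_unique]
    simp [edgeSum, otherComponents, rootComponent, contract]
  | graft a t s iht ihs =>
    have h := Fintype.sum_equiv (edgeSetGraft a t s)
      (fun σ => ((otherComponents (graft a t s) σ).map w).prod *
        f (rootComponent (graft a t s) σ) (contract (graft a t s) σ))
      (fun p => if p.1 then
          (((otherComponents t p.2.1).map w).prod * ((otherComponents s p.2.2).map w).prod) *
            f (graft a (rootComponent t p.2.1) (rootComponent s p.2.2))
              (join (contract t p.2.1) (contract s p.2.2))
        else (w (RTree.mk (rootComponent t p.2.1)) * (((otherComponents t p.2.1).map w).prod *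
            ((otherComponents s p.2.2).map w).prod)) *
            f (rootComponent s p.2.2) (graft a (contract t p.2.1) (contract s p.2.2))) (by
        intro σ
        have e : edgeSetGraft a t s σ = (σ.new, σ.fst, σ.snd) := rfl
        simp only [otherComponents, rootComponent, contract, e]
        cases EdgeSet.new σ <;> simp)
    rw [h, Fintype.sum_prod_type, Fintype.sum_bool, ← Finset.sum_add_distrib,
      Fintype.sum_prod_type]
    simp only [edgeSum, iht, ihs, Finset.mul_sum, if_true, Bool.false_eq_true, if_false]
    refine Finset.sum_congr rfl fun _ _ => Finset.sum_congr rfl fun _ _ => ?_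
    ring

theorem edgeSum_add (w : RTree A → B) (t : PTree A) (f g : PTree A → PTree A → B) :
    edgeSum w t (fun r c => f r c + g r c) = edgeSum w t f + edgeSum w t g := by
  simp only [edgeSum_eq_sum, mul_add, Finset.sum_add_distrib]

theorem mul_edgeSum (w : RTree A → B) (t : PTree A) (b : B) (f : PTree A → PTree A → B) :
    b * edgeSum w t f = edgeSum w t fun r c => b * f r c := by
  simp only [edgeSum_eq_sum, Finset.mul_sum, mul_left_comm]

theorem edgeSum_mul (w : RTree A → B) (t : PTree A) (b : B) (f : PTree A → PTree A → B) :
    edgeSum w t f * b = edgeSum w t fun r c => f r c * b := by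
  simp only [edgeSum_eq_sum, Finset.sum_mul, mul_assoc]

theorem edgeSum_zero (w : RTree A → B) (t : PTree A) :
    edgeSum w t (fun _ _ => 0) = 0 := by
  simp [edgeSum_eq_sum]

theorem edgeSum_comm (w w' : RTree A → B) (t s : PTree A)
    (f : PTree A → PTree A → PTree A → PTree A → B) :
    (edgeSum w t fun r c => edgeSum w' s fun r' c' => f r c r' c') =
      edgeSum w' s fun r' c' => edgeSum w t fun r c => f r c r' c' := by
  simp only [edgeSum_eq_sum, Finset.mul_sum]
  rw [Finset.sum_comm]
  simp only [mul_left_comm]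

/-- Subsets split along the two factors; only their root components merge. -/
theorem edgeSum_join (w : RTree A → B) (t s : PTree A) (f : PTree A → PTree A → B) :
    edgeSum w (join t s) f =
      edgeSum w t fun r c => edgeSum w s fun r' c' => f (join r r') (join c c') := by
  induction t generalizing f with
  | nil => rfl
  | graft a t t' _ ih =>
    simp only [join, edgeSum, ih, join_assoc, edgeSum_add, mul_edgeSum]

/-- Extraction from the extracted forest amounts to extraction from the contracted forest. -/
theorem edgeSum_edgeSum (x y z : RTree A → B)
    (h : ∀ t : PTree A,
      z (RTree.mk t) = edgeSum x t fun r c => x (RTree.mk r) * y (RTree.mk c))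
    (t : PTree A) (g : PTree A → PTree A → PTree A → B) :
    (edgeSum z t fun r c => edgeSum x r fun p q => g p q c) =
      edgeSum x t fun p c' => edgeSum y c' fun q c => g p q c := by
  induction t generalizing g with
  | nil => rfl
  | graft a t s iht ihs =>
    -- The three summands are the three fates of the new edge: extracted into `p`, extracted into
    -- `q`, or kept in `c`. Both iterated sums produce them.
    let G : PTree A → PTree A → PTree A → PTree A → PTree A → PTree A → B :=
      fun p₁ q₁ c₁ p₂ q₂ c₂ => g (graft a p₁ p₂) (join q₁ q₂) (join c₁ c₂) +
        x (RTree.mk p₁) * (g p₂ (graft a q₁ q₂) (join c₁ c₂) +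
          y (RTree.mk q₁) * g p₂ q₂ (graft a c₁ c₂))
    have hl : (edgeSum z (graft a t s) fun r c => edgeSum x r fun p q => g p q c) =
        edgeSum z t fun r₁ c₁ => edgeSum x r₁ fun p₁ q₁ => edgeSum z s fun r₂ c₂ =>
          edgeSum x r₂ fun p₂ q₂ => G p₁ q₁ c₁ p₂ q₂ c₂ := by
      simp only [edgeSum]
      congr 1
      funext r₁ c₁
      rw [edgeSum_comm]
      congr 1
      funext r₂ c₂
      -- When the new edge is kept, `r₁` is cut off from the root and weighted by `z`; the
      -- hypothesis expands this weight into a sum over `p₁`, `q₁`.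
      rw [h, edgeSum_mul, ← edgeSum_add]
      congr 1
      funext p₁ q₁
      rw [mul_edgeSum, ← edgeSum_add]
      congr 1
      funext p₂ q₂
      simp only [G]
      ring
    have hr : (edgeSum x (graft a t s) fun p c' => edgeSum y c' fun q c => g p q c) =
        edgeSum x t fun p₁ c₁' => edgeSum y c₁' fun q₁ c₁ => edgeSum x s fun p₂ c₂' =>
          edgeSum y c₂' fun q₂ c₂ => G p₁ q₁ c₁ p₂ q₂ c₂ := by
      simp only [edgeSum]
      congr 1
      funext p₁ c₁'
      rw [edgeSum_comm]
      congr 1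
      funext p₂ c₂'
      rw [edgeSum_join, mul_edgeSum, ← edgeSum_add]
      congr 1
      funext q₁ c₁
      rw [mul_edgeSum, ← edgeSum_add]
    rw [hl, hr, ← iht]
    simp only [ihs]

/-- Contraction never increases the number of edges. -/
theorem edgeSum_congr_of_size_le (w : RTree A → B) (t : PTree A) (f g : PTree A → PTree A → B)
    (h : ∀ r c, size c ≤ size t → f r c = g r c) : edgeSum w t f = edgeSum w t g := by
  induction t generalizing f g with
  | nil => exact h _ _ le_rfl
  | graft a t s iht ihs =>
    refine iht _ _ fun r c hc => ihs _ _ fun r' c' hc' => ?_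
    rw [h, h] <;> simp only [size, size_join] <;> omega

/-- If only the full contracted tree contributes, then the sum reduces to the empty subset. -/
theorem edgeSum_eq_of_size_lt (w : RTree A → B) (hw : w 1 = 1) (t : PTree A)
    (f : PTree A → PTree A → B) (h : ∀ r c, size c < size t → f r c = 0) :
    edgeSum w t f = f nil t := by
  induction t generalizing f with
  | nil => rfl
  | graft a t s iht ihs =>
    rw [edgeSum, iht]
    · rw [edgeSum_congr_of_size_le w s _ fun r' c' => f r' (graft a t c')]
      · exact ihs _ fun r c hc => h _ _ (by simp only [size]; omega)
      · intro r c hc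
        rw [h _ _ (by simp only [size, size_join]; omega), RTree.mk_nil, hw, zero_add, one_mul]
    · intro r c hc
      rw [edgeSum_congr_of_size_le w s _ fun _ _ => 0, edgeSum_zero]
      intro r' c' hc'
      rw [h _ _ (by simp only [size, size_join]; omega), h _ _ (by simp only [size]; omega)]
      simp

/-- Only the empty subset has no component with an edge. This gives the left unit law. -/
theorem edgeSum_of_rootComponent_nil (w : RTree A → B) (hw : w 1 = 1)
    (hw' : ∀ r : PTree A, r ≠ nil → w (RTree.mk r) = 0) (t : PTree A)
    (f : PTree A → PTree A → B) (h : ∀ r c, r ≠ nil → f r c = 0) :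
    edgeSum w t f = f nil t := by
  induction t generalizing f with
  | nil => rfl
  | graft a t s iht ihs =>
    have h₁ : ∀ r c, (edgeSum w s fun r' c' =>
        f (graft a r r') (join c c') + w (RTree.mk r) * f r' (graft a c c')) =
        w (RTree.mk r) * f nil (graft a c s) := by
      intro r c
      rw [ihs]
      · rw [h _ _ (by simp), zero_add]
      · intro r' c' hr'
        rw [h _ _ (by simp), h _ _ hr', mul_zero, zero_add]
    simp only [edgeSum, h₁]
    rw [iht _ fun r c hr => by rw [hw' r hr, zero_mul], RTree.mk_nil, hw, one_mul]

/-- Only the full subset contracts the tree to a node. This gives the right unit law. -/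
theorem edgeSum_of_contract_nil (w : RTree A → B) (t : PTree A)
    (f : PTree A → PTree A → B) (h : ∀ r c, c ≠ nil → f r c = 0) :
    edgeSum w t f = f t nil := by
  induction t generalizing f with
  | nil => rfl
  | graft a t s iht ihs =>
    have h₁ : ∀ r c, (edgeSum w s fun r' c' =>
        f (graft a r r') (join c c') + w (RTree.mk r) * f r' (graft a c c')) =
        f (graft a r s) c := by
      intro r c
      rw [ihs]
      · rw [h _ (graft a c nil) (by simp), mul_zero, add_zero, join_nil]
      · intro r' c' hr'
        rw [h _ (join c c') fun e => hr' (join_eq_nil e).2, h _ _ (by simp), mul_zero, zero_add]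
    simp only [edgeSum, h₁]
    exact iht _ fun r c hc => h _ _ hc

end Semiring

end PTree

end WickTrees

namespace WickTrees

universe u v

/-! ### The convolution monoid of characters and its action on linear functionals. -/

section Characters

variable {A : Type u} {B : Type v} [CommRing B] [Algebra ℝ B]

theorem algHom_ext_treeForest {α β : ForestAlgebra A →ₐ[ℝ] B}
    (h : ∀ t : PTree A, α (treeForest (RTree.mk t)) = β (treeForest (RTree.mk t))) : α = β := by
  refine MvPolynomial.algHom_ext fun τ => ?_
  obtain ⟨⟨t⟩, ht⟩ := τ
  have := h t
  rwa [treeForest, dif_neg (show RTree.mk t ≠ 1 from ht)] at this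

/-- The convolution product of algebra morphisms to a commutative algebra. -/
noncomputable def convAlgHom (α β : ForestAlgebra A →ₐ[ℝ] B) : ForestAlgebra A →ₐ[ℝ] B :=
  (Algebra.TensorProduct.productMap α β).comp coproduct

/-- Multiplicativity of `α` turns the extracted forest into a product of weights over components. -/
theorem convAlgHom_treeForest (α β : ForestAlgebra A →ₐ[ℝ] B) (t : PTree A) :
    convAlgHom α β (treeForest (RTree.mk t)) =
      PTree.edgeSum (fun τ => α (treeForest τ)) t fun r c =>
        α (treeForest (RTree.mk r)) * β (treeForest (RTree.mk c)) := by
  rw [convAlgHom, AlgHom.comp_apply, coproduct_treeForest, map_sum, PTree.edgeSum_eq_sum]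
  refine Finset.sum_congr rfl fun σ _ => ?_
  rw [Algebra.TensorProduct.productMap_apply_tmul, PTree.subforest, PTree.components,
    Multiset.map_cons, Multiset.prod_cons, map_mul, map_multiset_prod, Multiset.map_map]
  simp only [Function.comp_def]
  ring

/-- Both sides are multiplicative, so trees suffice; there it is `edgeSum_edgeSum` with `z` the
values of the convolution of `α` and `β`. -/
theorem convAlgHom_assoc (α β γ : ForestAlgebra A →ₐ[ℝ] B) :
    convAlgHom (convAlgHom α β) γ = convAlgHom α (convAlgHom β γ) := by
  refine algHom_ext_treeForest fun t => ?_
  have h := PTree.edgeSum_edgeSum (fun τ => α (treeForest τ)) (fun τ => β (treeForest τ))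
    (fun τ => convAlgHom α β (treeForest τ)) (convAlgHom_treeForest α β) t fun p q c =>
      α (treeForest (RTree.mk p)) * (β (treeForest (RTree.mk q)) * γ (treeForest (RTree.mk c)))
  rw [convAlgHom_treeForest, convAlgHom_treeForest]
  simp only [convAlgHom_treeForest β γ, PTree.mul_edgeSum, ← h]
  congr 1
  funext r c
  simp only [convAlgHom_treeForest α β, PTree.edgeSum_mul, mul_assoc]

/-- The counit with values in a commutative algebra. -/
noncomputable def counitAlg (A : Type u) (B : Type v) [CommRing B] [Algebra ℝ B] :
    ForestAlgebra A →ₐ[ℝ] B :=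
  (Algebra.ofId ℝ B).comp counit

theorem counit_treeForest {τ : RTree A} (h : τ ≠ 1) : counit (treeForest τ) = 0 := by
  rw [treeForest, dif_neg h, counit, MvPolynomial.aeval_X]

theorem PTree.Iso.eq_nil_iff {t s : PTree A} (h : PTree.Iso t s) :
    t = PTree.nil ↔ s = PTree.nil := by
  induction h with
  | refl t => rfl
  | symm _ ih => exact ih.symm
  | trans _ _ ih₁ ih₂ => exact ih₁.trans ih₂
  | congr => simp
  | swap => simp

theorem mk_ne_one {t : PTree A} (h : t ≠ PTree.nil) : RTree.mk t ≠ 1 := fun e =>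
  h ((PTree.Iso.eq_nil_iff (RTree.mk_eq_mk.1 (e.trans RTree.mk_nil.symm))).2 rfl)

theorem counitAlg_mk {t : PTree A} (h : t ≠ PTree.nil) :
    counitAlg A B (treeForest (RTree.mk t)) = 0 := by
  rw [counitAlg, AlgHom.comp_apply, counit_treeForest (mk_ne_one h), map_zero]

theorem counitAlg_convAlgHom (α : ForestAlgebra A →ₐ[ℝ] B) :
    convAlgHom (counitAlg A B) α = α := by
  refine algHom_ext_treeForest fun t => ?_
  rw [convAlgHom_treeForest, PTree.edgeSum_of_rootComponent_nil]
  · rw [RTree.mk_nil, treeForest_one, map_one, one_mul]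
  · rw [treeForest_one, map_one]
  · exact fun r hr => counitAlg_mk hr
  · intro r c hr
    rw [counitAlg_mk hr, zero_mul]

theorem convAlgHom_counitAlg (α : ForestAlgebra A →ₐ[ℝ] B) :
    convAlgHom α (counitAlg A B) = α := by
  refine algHom_ext_treeForest fun t => ?_
  rw [convAlgHom_treeForest, PTree.edgeSum_of_contract_nil]
  · rw [RTree.mk_nil, treeForest_one, map_one, mul_one]
  · intro r c hc
    rw [counitAlg_mk hc, mul_zero]

theorem counitAlg_real : counitAlg A ℝ = counit := by
  ext; simp [counitAlg]

theorem conv_toLinearMap (α β : ForestAlgebra A →ₐ[ℝ] ℝ) :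
    conv α.toLinearMap β.toLinearMap = (convAlgHom α β).toLinearMap := by
  rw [convAlgHom, Algebra.TensorProduct.productMap_eq_comp_map]
  rfl

theorem isConvInverse_toLinearMap {α β : ForestAlgebra A →ₐ[ℝ] ℝ} :
    IsConvInverse α.toLinearMap β.toLinearMap ↔
      convAlgHom α β = counit ∧ convAlgHom β α = counit := by
  simp only [IsConvInverse, conv_toLinearMap, AlgHom.toLinearMap_injective.eq_iff]

/-- The operator `(id ⊗ β) Δ` on the forest algebra. -/
noncomputable def rightAction (β : ForestAlgebra A →ₐ[ℝ] ℝ) :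
    ForestAlgebra A →ₐ[ℝ] ForestAlgebra A :=
  convAlgHom (AlgHom.id ℝ _) ((Algebra.ofId ℝ _).comp β)

theorem comp_convAlgHom {B' : Type*} [CommRing B'] [Algebra ℝ B'] (φ : B →ₐ[ℝ] B')
    (α β : ForestAlgebra A →ₐ[ℝ] B) :
    φ.comp (convAlgHom α β) = convAlgHom (φ.comp α) (φ.comp β) := by
  rw [convAlgHom, convAlgHom, ← AlgHom.comp_assoc]
  congr 1
  ext <;> simp

theorem comp_ofId_comp {B' : Type*} [CommRing B'] [Algebra ℝ B'] (φ : B →ₐ[ℝ] B')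
    (β : ForestAlgebra A →ₐ[ℝ] ℝ) :
    φ.comp ((Algebra.ofId ℝ B).comp β) = (Algebra.ofId ℝ B').comp β := by
  ext; simp [Algebra.ofId_apply]

/-- Associativity applied to the identity, viewed as a morphism with values in the forest algebra
itself; scalar-valued factors are unchanged by composition with an algebra morphism. -/
theorem rightAction_comp (β γ : ForestAlgebra A →ₐ[ℝ] ℝ) :
    (rightAction β).comp (rightAction γ) = rightAction (convAlgHom β γ) := by
  nth_rw 2 [rightAction]
  rw [comp_convAlgHom, AlgHom.comp_id, comp_ofId_comp, rightAction, convAlgHom_assoc,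
    ← comp_convAlgHom]
  rfl

theorem rightAction_counit : rightAction (counit : ForestAlgebra A →ₐ[ℝ] ℝ) = AlgHom.id ℝ _ :=
  convAlgHom_counitAlg _

theorem conv_toLinearMap_right (α : ForestAlgebra A →ₗ[ℝ] ℝ) (β : ForestAlgebra A →ₐ[ℝ] ℝ) :
    conv α β.toLinearMap = α ∘ₗ (rightAction β).toLinearMap := by
  have h : LinearMap.mul' ℝ ℝ ∘ₗ TensorProduct.map α β.toLinearMap =
      α ∘ₗ (Algebra.TensorProduct.productMap (AlgHom.id ℝ (ForestAlgebra A))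
        ((Algebra.ofId ℝ _).comp β)).toLinearMap := by
    refine TensorProduct.ext' fun x y => ?_
    have : x * algebraMap ℝ (ForestAlgebra A) (β y) = β y • x := by
      rw [Algebra.smul_def, mul_comm]
    simp only [LinearMap.comp_apply, TensorProduct.map_tmul, LinearMap.mul'_apply,
      AlgHom.toLinearMap_apply, Algebra.TensorProduct.productMap_apply_tmul, AlgHom.id_apply,
      AlgHom.comp_apply, Algebra.ofId_apply, this, map_smul, smul_eq_mul, mul_comm (α x)]
  rw [conv, ← LinearMap.comp_assoc, h]
  rfl

/-- Here `α` is only linear, so associativity for characters does not apply directly. Instead, the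
right actions of `β` and `γ` compose to the identity, and `α = α ∘ R_β ∘ R_γ = ε ∘ R_γ = γ`. -/
theorem eq_of_conv_eq_counit {α : ForestAlgebra A →ₗ[ℝ] ℝ} {β γ : ForestAlgebra A →ₐ[ℝ] ℝ}
    (h : conv α β.toLinearMap = counit.toLinearMap) (h' : convAlgHom β γ = counit) :
    α = γ.toLinearMap := by
  have h₁ : α ∘ₗ (rightAction β).toLinearMap ∘ₗ (rightAction γ).toLinearMap = α := by
    rw [← AlgHom.comp_toLinearMap, rightAction_comp, h', rightAction_counit]
    rfl
  rw [← LinearMap.comp_assoc, ← conv_toLinearMap_right α β, h, ← conv_toLinearMap_right] at h₁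
  rw [← h₁, conv_toLinearMap, ← counitAlg_real, counitAlg_convAlgHom]

end Characters

/-! ### Existence of convolution inverses. -/

section Inverse

variable {A : Type u}

theorem apply_psi_single (α : ForestAlgebra A →ₐ[ℝ] ℝ) (φ : TreeSpace A →ₗ[ℝ] ℝ) (t : PTree A) :
    φ (psi α.toLinearMap (Finsupp.single (RTree.mk t) 1)) =
      PTree.edgeSum (fun τ => α (treeForest τ)) t fun r c =>
        α (treeForest (RTree.mk r)) * φ (Finsupp.single (RTree.mk c) 1) := by
  have h : coaction (Finsupp.single (RTree.mk t) (1 : ℝ)) = t.extract := by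
    simp only [coaction, Finsupp.linearCombination_single, one_smul]
    rfl
  simp only [psi, LinearMap.comp_apply, h, PTree.extract, map_sum, PTree.edgeSum_eq_sum]
  refine Finset.sum_congr rfl fun σ _ => ?_
  rw [PTree.subforest, PTree.components, Multiset.map_cons, Multiset.prod_cons]
  simp only [LinearMap.rTensor_tmul, LinearEquiv.coe_coe, TensorProduct.lid_tmul, map_smul,
    AlgHom.toLinearMap_apply, map_mul, map_multiset_prod, Multiset.map_map, Function.comp_def,
    smul_eq_mul]
  ring

theorem convAlgHom_eq_apply_psi (α β : ForestAlgebra A →ₐ[ℝ] ℝ) (c : TreeSpace A) :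
    convAlgHom α β (embed c) = β (embed (psi α.toLinearMap c)) := by
  have h : (convAlgHom α β).toLinearMap ∘ₗ embed =
      (β.toLinearMap ∘ₗ embed) ∘ₗ psi α.toLinearMap := by
    refine Finsupp.lhom_ext' fun τ => LinearMap.ext_ring ?_
    obtain ⟨t⟩ := τ
    have h₁ := apply_psi_single α (β.toLinearMap ∘ₗ embed) t
    have h₂ := convAlgHom_treeForest α β t
    simp only [LinearMap.comp_apply, AlgHom.toLinearMap_apply, embed_single] at h₁
    simp only [LinearMap.comp_apply, AlgHom.toLinearMap_apply]
    exact ((congrArg _ (embed_single _)).trans h₂).trans h₁.symm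
  exact LinearMap.congr_fun h c

/-- Successive approximations of the right convolution inverse of `α`, as a functional on trees. -/
noncomputable def rightInvApprox (α : ForestAlgebra A →ₐ[ℝ] ℝ) : ℕ → TreeSpace A →ₗ[ℝ] ℝ
  | 0 => 0
  | n + 1 => counit.toLinearMap ∘ₗ embed -
      rightInvApprox α n ∘ₗ (psi α.toLinearMap - LinearMap.id)

theorem rightInvApprox_succ (α : ForestAlgebra A →ₐ[ℝ] ℝ) (n : ℕ) (c : TreeSpace A) :
    rightInvApprox α (n + 1) c = counit (embed c) -
      (rightInvApprox α n (psi α.toLinearMap c) - rightInvApprox α n c) := by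
  simp [rightInvApprox]

/-- Unitriangularity of `ψ_α`: the empty subset returns the tree itself, every other subset a tree
with fewer edges. -/
theorem apply_psi_single_of_size_lt (α : ForestAlgebra A →ₐ[ℝ] ℝ) (φ : TreeSpace A →ₗ[ℝ] ℝ)
    (t : PTree A) (h : ∀ c : PTree A, c.size < t.size → φ (Finsupp.single (RTree.mk c) 1) = 0) :
    φ (psi α.toLinearMap (Finsupp.single (RTree.mk t) 1)) =
      φ (Finsupp.single (RTree.mk t) 1) := by
  rw [apply_psi_single, PTree.edgeSum_eq_of_size_lt]
  · rw [RTree.mk_nil, treeForest_one, map_one, one_mul]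
  · rw [treeForest_one, map_one]
  · intro r c hc
    rw [h c hc, mul_zero]

/-- Each step composes the difference of consecutive approximations with `-(ψ_α - id)`, so it gains
one more size on which that difference vanishes. -/
theorem rightInvApprox_stable (α : ForestAlgebra A →ₐ[ℝ] ℝ) (n : ℕ) (t : PTree A)
    (h : t.size < n) : rightInvApprox α (n + 1) (Finsupp.single (RTree.mk t) 1) =
      rightInvApprox α n (Finsupp.single (RTree.mk t) 1) := by
  induction n generalizing t with
  | zero => omega
  | succ n ih =>
    have := apply_psi_single_of_size_lt α (rightInvApprox α (n + 1) - rightInvApprox α n) t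
      fun c hc => sub_eq_zero.2 (ih c (by omega))
    simp only [LinearMap.sub_apply] at this
    have h₁ := rightInvApprox_succ α (n + 1) (Finsupp.single (RTree.mk t) 1)
    have h₂ := rightInvApprox_succ α n (Finsupp.single (RTree.mk t) 1)
    linarith

theorem exists_eventually_rightInvApprox (α : ForestAlgebra A →ₐ[ℝ] ℝ) (τ : RTree A) :
    ∃ v : ℝ, ∀ᶠ n in Filter.atTop, rightInvApprox α n (Finsupp.single τ 1) = v := by
  obtain ⟨t⟩ := τ
  refine ⟨rightInvApprox α (t.size + 1) (Finsupp.single (RTree.mk t) 1),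
    Filter.eventually_atTop.2 ⟨t.size + 1, fun n hn => ?_⟩⟩
  induction n, hn using Nat.le_induction with
  | base => rfl
  | succ n hn ih => exact (rightInvApprox_stable α n t hn).trans ih

theorem exists_functional_comp_psi (α : ForestAlgebra A →ₐ[ℝ] ℝ) :
    ∃ ρ : TreeSpace A →ₗ[ℝ] ℝ, ρ ∘ₗ psi α.toLinearMap = counit.toLinearMap ∘ₗ embed := by
  choose v hv using exists_eventually_rightInvApprox α
  let ρ : TreeSpace A →ₗ[ℝ] ℝ := Finsupp.linearCombination ℝ v
  have hρ : ∀ c, ∀ᶠ n in Filter.atTop, rightInvApprox α n c = ρ c := by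
    intro c
    induction c using Finsupp.induction_linear with
    | zero => simp
    | add f g hf hg =>
      filter_upwards [hf, hg] with n h₁ h₂
      rw [map_add, map_add, h₁, h₂]
    | single τ b =>
      filter_upwards [hv τ] with n hn
      rw [← mul_one b, ← smul_eq_mul, ← Finsupp.smul_single, map_smul, map_smul, hn]
      simp [ρ]
  refine ⟨ρ, LinearMap.ext fun c => ?_⟩
  -- For a single large `n` the recursion involves only limit values, and so becomes the fixed-point
  -- equation for `ρ`.
  obtain ⟨n, h₁, h₂, h₃⟩ := ((hρ c).and ((hρ (psi α.toLinearMap c)).and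
    ((Filter.tendsto_add_atTop_nat 1).eventually (hρ c)))).exists
  rw [rightInvApprox_succ, h₁, h₂] at h₃
  simp only [LinearMap.comp_apply, AlgHom.toLinearMap_apply]
  linarith

theorem psi_single_one (α : ForestAlgebra A →ₐ[ℝ] ℝ) (φ : TreeSpace A →ₗ[ℝ] ℝ) :
    φ (psi α.toLinearMap (Finsupp.single 1 1)) = φ (Finsupp.single 1 1) :=
  apply_psi_single_of_size_lt α φ PTree.nil fun _ hc => absurd hc (Nat.not_lt_zero _)

theorem exists_convAlgHom_eq_counit (α : ForestAlgebra A →ₐ[ℝ] ℝ) :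
    ∃ β : ForestAlgebra A →ₐ[ℝ] ℝ, convAlgHom α β = counit := by
  obtain ⟨ρ, hρ⟩ := exists_functional_comp_psi α
  have hρ' : ∀ c, ρ (psi α.toLinearMap c) = counit (embed c) := LinearMap.congr_fun hρ
  let β : ForestAlgebra A →ₐ[ℝ] ℝ := MvPolynomial.aeval fun τ => ρ (Finsupp.single τ.1 1)
  have hβ : β.toLinearMap ∘ₗ embed = ρ := by
    refine Finsupp.lhom_ext' fun τ => LinearMap.ext_ring ?_
    simp only [LinearMap.comp_apply, AlgHom.toLinearMap_apply, Finsupp.lsingle_apply, embed_single]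
    by_cases h : τ = 1
    -- A unital extension needs `ρ` to be `1` at the one-node tree; this holds because `ψ_α` fixes
    -- that tree.
    · rw [h, treeForest_one, map_one, ← psi_single_one α ρ, hρ', embed_single, treeForest_one,
        map_one]
    · rw [treeForest, dif_neg h]
      exact MvPolynomial.aeval_X _ _
  refine ⟨β, algHom_ext_treeForest fun t => ?_⟩
  rw [← embed_single, convAlgHom_eq_apply_psi, ← hρ', ← hβ]
  rfl

/-- In a monoid where every element has a right inverse, right inverses are two-sided. -/
theorem convAlgHom_comm_of_eq_counit {α β : ForestAlgebra A →ₐ[ℝ] ℝ}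
    (h : convAlgHom α β = counit) : convAlgHom β α = counit := by
  obtain ⟨γ, hγ⟩ := exists_convAlgHom_eq_counit β
  have : α = γ := by
    rw [← convAlgHom_counitAlg α, counitAlg_real, ← hγ, ← convAlgHom_assoc, h, ← counitAlg_real,
      counitAlg_convAlgHom]
  rwa [this]

end Inverse

/-! ### Integrability and the character of means. -/

section Moments

variable {A : Type u} {d : ℕ} {Ω : Type*} [MeasurableSpace Ω] {P : Measure Ω}
  {X : Ω → PlantedTree A → C(Space d, ℝ)}

theorem HasFiniteMoments.memLp (hX : Measurable X) (hmom : HasFiniteMoments X P)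
    (τ : PlantedTree A) (p : ℕ) : MemLp (fun ω => X ω τ 0) p P := by
  have hm : Measurable fun ω => X ω τ 0 :=
    (ContinuousEvalConst.continuous_eval_const (0 : Space d)).measurable.comp (measurable_pi_iff.1 hX τ)
  rcases eq_or_ne p 0 with rfl | hp
  · simpa using hm.aestronglyMeasurable
  · rw [← integrable_norm_rpow_iff hm.aestronglyMeasurable (by exact_mod_cast hp)
      (ENNReal.natCast_ne_top p)]
    simpa using hmom τ p

variable [IsProbabilityMeasure P]

theorem HasFiniteMoments.memLp_canonicalLift (hX : Measurable X) (hmom : HasFiniteMoments X P)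
    (t : PTree A) (p : ℕ) : MemLp (fun ω => canonicalLift (X ω) (RTree.mk t) 0) p P := by
  induction t generalizing p with
  | nil => exact memLp_const (1 : ℝ)
  | graft a t s _ ih =>
    -- Hölder with `1/(2p) + 1/(2p) = 1/p`; the exponent doubles with each factor, hence the
    -- induction over all `p` at once.
    have : ENNReal.HolderTriple ((2 * p : ℕ) : ENNReal) ((2 * p : ℕ) : ENNReal) p := ⟨by
      rw [Nat.cast_mul, ENNReal.mul_inv (by simp) (by simp), ← add_mul]
      simp [ENNReal.inv_two_add_inv_two]⟩
    exact (ih (2 * p)).mul' (hmom.memLp hX ⟨RTree.plant a (RTree.mk t), a, RTree.mk t, rfl⟩ (2 * p))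

theorem liftC_apply_zero (Φ : PlantedTree A → C(Space d, ℝ)) (c : TreeSpace A) :
    liftC Φ c 0 = c.sum fun τ b => b * canonicalLift Φ τ 0 := by
  simp [liftC, Finsupp.linearCombination_apply, Finsupp.sum, ContinuousMap.sum_apply]

theorem HasFiniteMoments.integrable_canonicalLift (hX : Measurable X)
    (hmom : HasFiniteMoments X P) (τ : RTree A) :
    Integrable (fun ω => canonicalLift (X ω) τ 0) P := by
  obtain ⟨t⟩ := τ
  exact memLp_one_iff_integrable.1 (by exact_mod_cast hmom.memLp_canonicalLift hX t 1)

theorem HasFiniteMoments.integrable_liftC (hX : Measurable X) (hmom : HasFiniteMoments X P)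
    (c : TreeSpace A) : Integrable (fun ω => liftC (X ω) c 0) P := by
  simp only [liftC_apply_zero]
  exact integrable_finsetSum _ fun τ _ => (hmom.integrable_canonicalLift hX τ).const_mul _

theorem HasFiniteMoments.integral_liftC (hX : Measurable X) (hmom : HasFiniteMoments X P)
    (c : TreeSpace A) : ∫ ω, liftC (X ω) c 0 ∂P = mean X P c := by
  simp only [liftC_apply_zero, Finsupp.sum]
  rw [integral_finsetSum _ fun τ _ => (hmom.integrable_canonicalLift hX τ).const_mul _]
  simp only [integral_const_mul, mean, Finsupp.linearCombination_apply, Finsupp.sum, smul_eq_mul]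

/-- Total mass one is what allows a unital morphism to extend the means. -/
theorem mean_single_one : mean X P (Finsupp.single 1 1) = 1 := by
  simp [mean]

theorem meanChar_embed (c : TreeSpace A) : meanChar X P (embed c) = mean X P c := by
  have h : (meanChar X P).toLinearMap ∘ₗ embed = mean X P := by
    refine Finsupp.lhom_ext' fun τ => LinearMap.ext_ring ?_
    simp only [LinearMap.comp_apply, AlgHom.toLinearMap_apply, Finsupp.lsingle_apply, embed_single]
    by_cases h : τ = 1
    · rw [h, treeForest_one, map_one, mean_single_one]
    · rw [treeForest, dif_neg h]
      exact MvPolynomial.aeval_X _ _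
  exact LinearMap.congr_fun h c

end Moments

end WickTrees

/-! ### The centring character. -/

theorem theorem9p1 (m d : ℕ) {Ω : Type*} [MeasurableSpace Ω] (P : Measure Ω)
    [IsProbabilityMeasure P] (X : Ω → PlantedTree (Fin m) → C(Space d, ℝ))
    (hX : Measurable X) (hstat : IsStationaryFamily X P) (hmom : HasFiniteMoments X P) :
    -- all the expectations below are well defined
    (∀ c : TreeSpace (Fin m), Integrable (fun ω => liftC (X ω) c 0) P) ∧
    -- `meanChar X P` is the unique character which extends `mean X P`
    (∀ ν : ForestAlgebra (Fin m) →ₐ[ℝ] ℝ,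
      (∀ c : TreeSpace (Fin m), ν (embed c) = mean X P c) ↔ ν = meanChar X P) ∧
    -- it has exactly one convolution inverse, which is a character and the only centring one
    ∃ μinv : ForestAlgebra (Fin m) →ₐ[ℝ] ℝ,
      (∀ α : ForestAlgebra (Fin m) →ₗ[ℝ] ℝ,
        IsConvInverse α (meanChar X P).toLinearMap ↔ α = μinv.toLinearMap) ∧
      ∀ ℓ : ForestAlgebra (Fin m) →ₐ[ℝ] ℝ,
        (∀ τ : RTree (Fin m), τ ≠ 1 →
          ∫ ω, liftC (X ω) (psi ℓ.toLinearMap (Finsupp.single τ 1)) 0 ∂P = 0) ↔ ℓ = μinv := by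
  refine ⟨hmom.integrable_liftC hX, fun ν => ⟨fun h => ?_, ?_⟩, ?_⟩
  · refine algHom_ext_treeForest fun t => ?_
    rw [← embed_single, h, meanChar_embed]
  · rintro rfl
    exact meanChar_embed
  obtain ⟨β, hβ⟩ := exists_convAlgHom_eq_counit (meanChar X P)
  have hβ' := convAlgHom_comm_of_eq_counit hβ
  refine ⟨β, fun α => ⟨fun h => eq_of_conv_eq_counit h.1 hβ, ?_⟩, fun ℓ => ?_⟩
  · rintro rfl
    exact isConvInverse_toLinearMap.2 ⟨hβ', hβ⟩
  -- The centring condition becomes the vanishing of `ℓ ⋆ μ` on nonempty trees; its value on the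
  -- empty forest is automatically `1`.
  · simp only [hmom.integral_liftC hX, ← meanChar_embed, ← convAlgHom_eq_apply_psi, embed_single]
    refine ⟨fun h => ?_, ?_⟩
    · have hℓ : convAlgHom ℓ (meanChar X P) = counit := by
        refine algHom_ext_treeForest fun t => ?_
        by_cases ht : RTree.mk t = 1
        · rw [ht, treeForest_one, map_one, map_one]
        · rw [h _ ht, counit_treeForest ht]
      refine AlgHom.toLinearMap_injective (eq_of_conv_eq_counit ?_ hβ)
      rw [conv_toLinearMap, hℓ]
    · rintro rfl τ hτ
      rw [hβ', counit_treeForest hτ]
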